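/- For a permutation $\pi$ of $[n]=\{1,\dots,n\}$, a letter $\pi_i$ is a cyclic peak if $i<\pi_i>\pi_{\pi_i}$; let $\mathrm{cpk}(\pi)$ be the number of cyclic peaks of $\pi$. Let $\mathfrak D_n$ be the set of derangements (fixed-point-free permutations) of $[n]$, let $D_n^{\mathrm{cpk}}(t)=\sum_{\pi\in\mathfrak D_n}t^{\mathrm{cpk}(\pi)}$, and let $$D^{\mathrm{cpk}}(t;x)=1+\sum_{n\ge1}D_n^{\mathrm{cpk}}(t)\frac{x^n}{n!}.$$ Define $U_n(s,t)$ by $U_0(s,t)=1$, $U_1(s,t)=2t$ and $U_n(s,t)=2t\,U_{n-1}(s,t)-s\,U_{n-2}(s,t)$ for $n\ge2$, and let $V(s,t;x)=\sum_{n\ge0}U_n(s,t)\frac{x^{n+2}}{(n+2)!}$. Let the Pell numbers be given by $g_0=1$, $g_1=0$ and $g_n=2g_{n-1}+g_{n-2}$ for $n\ge2$, and let $G(x)=\sum_{n\ge0}g_n\frac{x^n}{n!}$. Then, as formal power series in $x$ (with $t$ an indeterminate or, more generally, an element of any commutative $\mathbb Q$-algebra), $$D^{\mathrm{cpk}}(t;x)=\frac{1}{1-t\,V(t,1;x)}.$$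 In particular, $D^{\mathrm{cpk}}(-1;x)=G(x)^{-1}$. -/

import Mathlib

/-- The exponential generating function `∑ aₙ xⁿ / n!` of a sequence `a`, as a formal power
series. -/
noncomputable def expGenFun {R : Type*} [CommRing R] [Algebra ℚ R] (a : ℕ → R) : PowerSeries R :=
  PowerSeries.mk fun n => ((n.factorial : ℚ)⁻¹) • a n

/-- The number of cyclic peaks of a permutation: the number of letters `π i` with
`i < π i > π (π i)`. -/
def cpk {n : ℕ} (π : Equiv.Perm (Fin n)) : ℕ :=
  (Finset.univ.filter fun i : Fin n => i < π i ∧ π (π i) < π i).card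

/-- The polynomial `Dₙ^st(t) = ∑ t ^ st(π)`, the sum being over all derangements `π` of an
`n`-element linearly ordered set, evaluated at an element `t` of a commutative ring (take
`R = ℚ[T]` and `t = T` for the polynomial itself). -/
def derangementPoly {R : Type*} [CommRing R] (st : ∀ {n : ℕ}, Equiv.Perm (Fin n) → ℕ)
    (t : R) (n : ℕ) : R :=
  ∑ π : derangements (Fin n), t ^ st (π : Equiv.Perm (Fin n))

/-- `D^cpk(t; x) = 1 + ∑_{n ≥ 1} Dₙ^cpk(t) xⁿ / n!`; the constant term is `1` because the empty
permutation is a derangement without cyclic peaks, see `constantCoeff_derangementEGF`. -/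
noncomputable def derangementEGF {R : Type*} [CommRing R] [Algebra ℚ R] (t : R) :
    PowerSeries R :=
  expGenFun (derangementPoly cpk t)

theorem constantCoeff_derangementEGF {R : Type*} [CommRing R] [Algebra ℚ R] (t : R) :
    PowerSeries.constantCoeff (derangementEGF t) = 1 := by
  have h : (Finset.univ : Finset (derangements (Fin 0))) = {⟨1, fun x => x.elim0⟩} := by decide
  simp [derangementEGF, expGenFun, derangementPoly, h, cpk]

/-- The two-parameter Chebyshev polynomials of the second kind, `Uₙ(s, t)`. -/
def chebyshevU₂ {R : Type*} [CommRing R] (s t : R) : ℕ → R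
  | 0 => 1
  | 1 => 2 * t
  | n + 2 => 2 * t * chebyshevU₂ s t (n + 1) - s * chebyshevU₂ s t n

/-- `V(s, t; x) = ∑_{n ≥ 0} Uₙ(s, t) x^(n+2) / (n+2)!`. -/
noncomputable def chebyshevV {R : Type*} [CommRing R] [Algebra ℚ R] (s t : R) : PowerSeries R :=
  expGenFun fun m => match m with
    | 0 => 0
    | 1 => 0
    | n + 2 => chebyshevU₂ s t n

/-- The Pell numbers, indexed so that they begin `1, 0, 1, 2, 5, 12, 29, …`. -/
def pell : ℕ → ℕ
  | 0 => 1
  | 1 => 0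
  | n + 2 => 2 * pell (n + 1) + pell n

/-- The Pell exponential generating function `G(x) = ∑ gₙ xⁿ / n!`. -/
noncomputable def pellEGF : PowerSeries ℚ :=
  expGenFun fun n => (pell n : ℚ)

/-! Inserting a new largest letter into a cycle yields a derangement exactly when the old
permutation has no fixed point other than the letter it is inserted before. This gives D_{n+2} =
2t(1-t) D'_{n+1} + (n+1)t (D_{n+1} + D_n) (`cyclicPeakPoly_option`), which becomes a first-order
transport equation for F = D^cpk.

By `chebyshevU₂_derivative`, W = 1 - tV satisfies the same equation with the zeroth-order term
negated. Hence FW satisfies the homogeneous equation with constant term 1, which forces FW = 1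
(`eq_one_of_transport`). This is done for an indeterminate t, where d/dt makes sense, and then
specialised. -/

/-- The cyclic peaks of a permutation `σ`, with letters compared through a height function `h`. -/
def cyclicPeaks {α : Type*} [Fintype α] (h : α → ℕ) (σ : Equiv.Perm α) : Finset α :=
  Finset.univ.filter fun p => h (σ.symm p) < h p ∧ h (σ p) < h p

theorem mem_cyclicPeaks {α : Type*} [Fintype α] {h : α → ℕ} {σ : Equiv.Perm α} {p : α} :
    p ∈ cyclicPeaks h σ ↔ h (σ.symm p) < h p ∧ h (σ p) < h p := by
  simp [cyclicPeaks]

theorem cpk_eq_card_cyclicPeaks {n : ℕ} (π : Equiv.Perm (Fin n)) :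
    cpk π = (cyclicPeaks Fin.val π).card := by
  refine Finset.card_bij (fun i _ => π i) ?_ (fun _ _ _ _ h => π.injective h) ?_
  · intro i hi
    simpa [mem_cyclicPeaks] using hi
  · intro p hp
    refine ⟨π.symm p, ?_, by simp⟩
    simpa [mem_cyclicPeaks] using hp

theorem card_cyclicPeaks_permCongr {α β : Type*} [Fintype α] [Fintype β] {h : α → ℕ} {k : β → ℕ}
    (e : α ≃ β) (he : ∀ x y, k (e x) < k (e y) ↔ h x < h y) (σ : Equiv.Perm α) :
    (cyclicPeaks k (e.permCongr σ)).card = (cyclicPeaks h σ).card := by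
  symm
  refine Finset.card_bij (fun i _ => e i) ?_ (fun _ _ _ _ h => e.injective h) ?_
  · intro p hp
    have : (e.permCongr σ).symm (e p) = e (σ.symm p) := by
      simp [Equiv.symm_apply_eq]
    simpa [mem_cyclicPeaks, this, he] using hp
  · intro q hq
    obtain ⟨p, rfl⟩ := e.surjective q
    have : (e.permCongr σ).symm (e p) = e (σ.symm p) := by
      simp [Equiv.symm_apply_eq]
    exact ⟨p, by simpa [mem_cyclicPeaks, this, he] using hq, rfl⟩

theorem symm_apply_notMem_cyclicPeaks {α : Type*} [Fintype α] (a : α) (π : Equiv.Perm α)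
    {h : α → ℕ} (ha : a ∈ cyclicPeaks h π) :
    π.symm a ∉ cyclicPeaks h π := by
  intro hb
  rw [mem_cyclicPeaks] at ha hb
  rw [Equiv.apply_symm_apply] at hb
  omega

/-! ### Inserting a largest letter into a cycle -/

/-- Insert the letter `none` into the cycle of `a`, just before `a`. -/
def insertNone {α : Type*} [DecidableEq α] (a : α) (π : Equiv.Perm α) : Equiv.Perm (Option α) :=
  Equiv.Perm.decomposeOption.symm (some a, π)

section insertNone
variable {α : Type*} [DecidableEq α] (a : α) (π : Equiv.Perm α)

theorem insertNone_none : insertNone a π none = some a := by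
  simp [insertNone]

theorem insertNone_some (x : α) :
    insertNone a π (some x) = if π x = a then none else some (π x) := by
  simp only [insertNone, Equiv.Perm.decomposeOption_symm_apply, Equiv.Perm.coe_mul,
    Function.comp_apply, Equiv.optionCongr_apply, Option.map_some, Equiv.swap_apply_def]
  simp

theorem insertNone_symm_none : (insertNone a π).symm none = some (π.symm a) := by
  rw [Equiv.symm_apply_eq, insertNone_some]; simp

theorem insertNone_symm_some (x : α) :
    (insertNone a π).symm (some x) = if x = a then none else some (π.symm x) := by
  rw [Equiv.symm_apply_eq]
  split_ifs with hx
  · rw [insertNone_none, hx]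
  · rw [insertNone_some]; simp [hx]

/-- The largest letter is always a peak, and its two new neighbours cannot be peaks; no other letter
changes neighbours. -/
theorem cyclicPeaks_insertNone [Fintype α] {h : Option α → ℕ} (hh : ∀ x, h (some x) < h none) :
    cyclicPeaks h (insertNone a π) =
      Finset.insertNone ((cyclicPeaks (h ∘ some) π \ {a, π.symm a})) := by
  ext p
  rcases p with _ | p
  · simp [mem_cyclicPeaks, insertNone_none, insertNone_symm_none, hh]
  · have h1 : p = π.symm a ↔ π p = a := by rw [Equiv.eq_symm_apply]
    have h2 := (hh p).not_gt
    rw [mem_cyclicPeaks, insertNone_some, insertNone_symm_some, Finset.some_mem_insertNone,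
      Finset.mem_sdiff, mem_cyclicPeaks, Finset.mem_insert, Finset.mem_singleton, h1]
    split_ifs <;> simp_all

theorem card_cyclicPeaks_insertNone [Fintype α] {h : Option α → ℕ}
    (hh : ∀ x, h (some x) < h none) :
    (cyclicPeaks h (insertNone a π)).card = (cyclicPeaks (h ∘ some) π).card +
      if a ∈ cyclicPeaks (h ∘ some) π ∨ π.symm a ∈ cyclicPeaks (h ∘ some) π then 0 else 1 := by
  rw [cyclicPeaks_insertNone a π hh, Finset.card_insertNone]
  set P := cyclicPeaks (h ∘ some) π
  by_cases ha : a ∈ P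
  · have hb : π.symm a ∉ P := symm_apply_notMem_cyclicPeaks a π ha
    rw [Finset.sdiff_insert, Finset.sdiff_singleton_eq_erase, Finset.erase_eq_of_notMem hb,
      Finset.card_erase_of_mem ha, if_pos (Or.inl ha)]
    have := Finset.card_pos.2 ⟨a, ha⟩
    omega
  · rw [Finset.sdiff_insert_of_notMem ha, Finset.sdiff_singleton_eq_erase]
    by_cases hb : π.symm a ∈ P
    · rw [Finset.card_erase_of_mem hb, if_pos (Or.inr hb)]
      have := Finset.card_pos.2 ⟨_, hb⟩
      omega
    · rw [Finset.erase_eq_of_notMem hb, if_neg (by tauto)]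

theorem card_cyclicPeaks_insertNone_of_fixed [Fintype α] {h : Option α → ℕ}
    (hh : ∀ x, h (some x) < h none) (ha : π a = a) :
    (cyclicPeaks h (insertNone a π)).card = (cyclicPeaks (h ∘ some) π).card + 1 := by
  have hs : π.symm a = a := by rw [Equiv.symm_apply_eq, ha]
  rw [card_cyclicPeaks_insertNone a π hh, if_neg]
  simp [mem_cyclicPeaks, hs]

/-- Insertion destroys the fixed point `a`, if it is one, but leaves every other fixed point intact
and creates none. -/
theorem insertNone_apply_ne_iff :
    (∀ o, insertNone a π o ≠ o) ↔ ∀ x, π x = x → x = a := by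
  constructor
  · intro H x hx
    by_contra hne
    exact H (some x) (by rw [insertNone_some, if_neg (by rwa [hx]), hx])
  · rintro H (_ | x)
    · simp [insertNone_none]
    · rw [insertNone_some]
      split_ifs with h
      · simp
      · intro h'
        have := Option.some.inj h'
        exact h (this.trans (H x this))

open Polynomial in
/-- Summing over all insertion positions. -/
theorem sum_X_pow_card_cyclicPeaks_insertNone [Fintype α] {h : Option α → ℕ}
    (hh : ∀ x, h (some x) < h none) :
    ∑ a, (X : ℚ[X]) ^ (cyclicPeaks h (insertNone a π)).card =
      2 * X * (1 - X) * derivative (X ^ (cyclicPeaks (h ∘ some) π).card) +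
        (Fintype.card α : ℚ[X]) * X * X ^ (cyclicPeaks (h ∘ some) π).card := by
  simp_rw [card_cyclicPeaks_insertNone _ π hh]
  set P := cyclicPeaks (h ∘ some) π with hP
  -- The two indicators are never both 1, since consecutive letters are not both peaks; so the
  -- disjunction is their sum. Each peak thus accounts for two positions that keep the count.
  have key (a : α) : (X : ℚ[X]) ^ (P.card + if a ∈ P ∨ π.symm a ∈ P then 0 else 1) =
      X ^ P.card * X + ((if a ∈ P then 1 else 0) + if π.symm a ∈ P then 1 else 0) *
        (X ^ P.card * (1 - X)) := by
    by_cases ha : a ∈ P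
    · have hb : π.symm a ∉ P := symm_apply_notMem_cyclicPeaks a π ha
      simp [ha, hb]; ring
    · by_cases hb : π.symm a ∈ P
      · simp [ha, hb]; ring
      · simp [ha, hb]; ring
  have hs : ∑ a, (if π.symm a ∈ P then (1 : ℚ[X]) else 0) = P.card := by
    rw [Equiv.sum_comp π.symm (fun a => if a ∈ P then (1 : ℚ[X]) else 0)]
    simp
  have hd : (X : ℚ[X]) * derivative (X ^ P.card) = (P.card : ℚ[X]) * X ^ P.card := by
    rcases P.card with _ | m
    · simp
    · simp; ring
  simp_rw [key, Finset.sum_add_distrib, ← Finset.sum_mul, Finset.sum_add_distrib, hs]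
  simp only [Finset.sum_const, Finset.card_univ, nsmul_eq_mul, Finset.sum_ite_mem,
    Finset.univ_inter, mul_one]
  linear_combination (-2 * (1 - X)) * hd

end insertNone

/-! ### The recurrence for derangement polynomials -/

section DerangementRecurrence
open Polynomial

theorem card_cyclicPeaks_ofSubtype {α : Type*} [Fintype α] {p : α → Prop} [DecidablePred p]
    (h : α → ℕ) (σ : Equiv.Perm (Subtype p)) :
    (cyclicPeaks h (Equiv.Perm.ofSubtype σ)).card = (cyclicPeaks (h ∘ Subtype.val) σ).card := by
  symm
  refine Finset.card_bij (fun i _ => i.1) ?_ (fun _ _ _ _ h => Subtype.ext h) ?_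
  · intro x hx
    rw [mem_cyclicPeaks] at hx ⊢
    rw [← Equiv.Perm.inv_def, ← map_inv, Equiv.Perm.ofSubtype_apply_coe,
      Equiv.Perm.ofSubtype_apply_coe]
    exact hx
  · intro x hx
    rw [mem_cyclicPeaks] at hx
    by_cases hp : p x
    · refine ⟨⟨x, hp⟩, ?_, rfl⟩
      rw [← Equiv.Perm.inv_def, ← map_inv, Equiv.Perm.ofSubtype_apply_of_mem _ hp,
        Equiv.Perm.ofSubtype_apply_of_mem _ hp] at hx
      rw [mem_cyclicPeaks]
      exact hx
    · rw [Equiv.Perm.ofSubtype_apply_of_not_mem _ hp] at hx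
      omega

/-- The cyclic peak polynomial of the derangements of `α`, with letters compared through `h`. -/
noncomputable def cyclicPeakPoly {α : Type*} [Fintype α] [DecidableEq α] (h : α → ℕ) : ℚ[X] :=
  ∑ σ : Equiv.Perm α with ∀ x, σ x ≠ x, X ^ (cyclicPeaks h σ).card

theorem derangementPoly_cpk_X (n : ℕ) :
    derangementPoly cpk (X : ℚ[X]) n = cyclicPeakPoly (Fin.val : Fin n → ℕ) := by
  rw [derangementPoly, cyclicPeakPoly]
  simp_rw [cpk_eq_card_cyclicPeaks]
  symm
  apply Finset.sum_subtype
  simp [derangements]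

theorem cyclicPeakPoly_congr {α β : Type*} [Fintype α] [DecidableEq α] [Fintype β] [DecidableEq β]
    {h : α → ℕ} {k : β → ℕ}
    (e : α ≃ β) (he : ∀ x y, k (e x) < k (e y) ↔ h x < h y) :
    cyclicPeakPoly k = cyclicPeakPoly h := by
  rw [cyclicPeakPoly, cyclicPeakPoly, Finset.sum_filter, Finset.sum_filter]
  refine (Fintype.sum_equiv e.permCongr _ _ fun σ => ?_).symm
  rw [card_cyclicPeaks_permCongr e he]
  congr 1
  rw [eq_iff_iff]
  exact e.forall_congr (by simp)

/-- A fixed point is not a peak and is adjacent to no other letter, so deleting it preserves the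
peaks. -/
theorem sum_unique_fixedPoint {α : Type*} [Fintype α] [DecidableEq α] (h : α → ℕ) (a : α) :
    ∑ π : Equiv.Perm α with ∀ x, π x = x ↔ x = a, (X : ℚ[X]) ^ (cyclicPeaks h π).card =
      cyclicPeakPoly (h ∘ (Subtype.val : {x // x ≠ a} → α)) := by
  rw [cyclicPeakPoly]
  symm
  refine Finset.sum_bij (fun σ _ => Equiv.Perm.ofSubtype σ) ?_
    (fun _ _ _ _ h => Equiv.Perm.ofSubtype_injective h) ?_ ?_
  · intro σ hσ
    simp only [Finset.mem_filter, Finset.mem_univ, true_and] at hσ ⊢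
    intro x
    constructor
    · intro hx
      by_contra hxa
      refine hσ ⟨x, hxa⟩ (Subtype.ext ?_)
      rwa [Equiv.Perm.ofSubtype_apply_of_mem (p := (· ≠ a)) _ hxa] at hx
    · intro hx
      exact Equiv.Perm.ofSubtype_apply_of_not_mem _ (not_not.2 hx)
  · intro π hπ
    simp only [Finset.mem_filter, Finset.mem_univ, true_and] at hπ
    have h1 : ∀ x, x ≠ a ↔ π x ≠ a := fun x => by
      rw [← (hπ a).2 rfl, Ne, Ne, (hπ a).2 rfl]
      conv_rhs => rw [← (hπ a).2 rfl, π.injective.eq_iff]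
    refine ⟨π.subtypePerm fun x => (h1 x).symm, ?_, ?_⟩
    · simp only [Finset.mem_filter, Finset.mem_univ, true_and]
      intro x hx
      exact x.2 ((hπ _).1 (congrArg Subtype.val hx))
    · exact Equiv.Perm.ofSubtype_subtypePerm (p := (· ≠ a)) _ fun x hx hxa => hx ((hπ x).2 hxa)
  · intro σ _
    rw [card_cyclicPeaks_ofSubtype]

theorem cyclicPeakPoly_option {α : Type*} [Fintype α] [DecidableEq α] {h : Option α → ℕ}
    (hh : ∀ x, h (some x) < h none) :
    cyclicPeakPoly h = 2 * X * (1 - X) * derivative (cyclicPeakPoly (h ∘ some)) +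
      (Fintype.card α : ℚ[X]) * X * cyclicPeakPoly (h ∘ some) +
      X * ∑ a, cyclicPeakPoly (h ∘ some ∘ (Subtype.val : {x // x ≠ a} → α)) := by
  -- Either `π` is already a derangement, or `a` is its only fixed point; in the latter case the
  -- insertion creates exactly one peak, whence the factor `X`.
  have hsplit (a : α) (π : Equiv.Perm α) :
      (if ∀ o, insertNone a π o ≠ o then
        (X : ℚ[X]) ^ (cyclicPeaks h (insertNone a π)).card else 0) =
      (if ∀ x, π x ≠ x then X ^ (cyclicPeaks h (insertNone a π)).card else 0) +
      X * (if ∀ x, π x = x ↔ x = a then X ^ (cyclicPeaks (h ∘ some) π).card else 0) := by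
    simp only [insertNone_apply_ne_iff]
    by_cases ha : π a = a
    · have h1 : ¬ ∀ x, π x ≠ x := fun H => H a ha
      have h2 : (∀ x, π x = x ↔ x = a) ↔ ∀ x, π x = x → x = a :=
        forall_congr' fun x => ⟨Iff.mp, fun H => ⟨H, fun hx => hx ▸ ha⟩⟩
      rw [if_neg h1, zero_add, card_cyclicPeaks_insertNone_of_fixed a π hh ha]
      simp only [h2]
      split_ifs <;> ring
    · have h1 : (∀ x, π x ≠ x) ↔ ∀ x, π x = x → x = a :=
        ⟨fun H x hx => (H x hx).elim, fun H x hx => ha (H x hx ▸ hx)⟩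
      have h2 : ¬ ∀ x, π x = x ↔ x = a := fun H => ha ((H a).2 rfl)
      simp only [h1, if_neg h2, mul_zero, add_zero]
  have h0 : cyclicPeakPoly h = ∑ a, ∑ π : Equiv.Perm α,
      if ∀ o, insertNone a π o ≠ o then
        (X : ℚ[X]) ^ (cyclicPeaks h (insertNone a π)).card else 0 := by
    rw [cyclicPeakPoly, Finset.sum_filter, ← Equiv.sum_comp Equiv.Perm.decomposeOption.symm,
      Fintype.sum_prod_type, Fintype.sum_option]
    -- The extra summand of the decomposition collects the permutations fixing `none`.
    refine (add_eq_right).2 (Finset.sum_eq_zero fun π _ => if_neg fun H => H none ?_)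
    simp
  have hU (a : α) : (∑ π : Equiv.Perm α,
      if ∀ x, π x = x ↔ x = a then (X : ℚ[X]) ^ (cyclicPeaks (h ∘ some) π).card else 0) =
      cyclicPeakPoly (h ∘ some ∘ (Subtype.val : {x // x ≠ a} → α)) := by
    rw [← Finset.sum_filter, sum_unique_fixedPoint]
    rfl
  rw [h0]
  simp_rw [hsplit, Finset.sum_add_distrib, ← Finset.mul_sum, hU]
  congr 1
  rw [Finset.sum_comm]
  simp only [cyclicPeakPoly, Finset.sum_filter, Finset.mul_sum, derivative_sum]
  rw [← Finset.sum_add_distrib]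
  refine Finset.sum_congr rfl fun π _ => ?_
  split_ifs
  · exact sum_X_pow_card_cyclicPeaks_insertNone π hh
  · simp

theorem cyclicPeakPoly_fin_succ_succ (n : ℕ) :
    cyclicPeakPoly (Fin.val : Fin (n + 2) → ℕ) =
      2 * X * (1 - X) * derivative (cyclicPeakPoly (Fin.val : Fin (n + 1) → ℕ)) +
      ((n : ℚ[X]) + 1) * X * (cyclicPeakPoly (Fin.val : Fin (n + 1) → ℕ) +
        cyclicPeakPoly (Fin.val : Fin n → ℕ)) := by
  let h : Option (Fin (n + 1)) → ℕ := fun o => o.elim (n + 1) Fin.val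
  have h1 : cyclicPeakPoly h = cyclicPeakPoly (Fin.val : Fin (n + 2) → ℕ) :=
    cyclicPeakPoly_congr finSuccEquivLast fun x y => by
      have (x : Fin (n + 2)) : h (finSuccEquivLast x) = x := by
        induction x using Fin.lastCases <;> simp [h]
      rw [this, this]
  have h2 (a : Fin (n + 1)) :
      cyclicPeakPoly (Fin.val : Fin n → ℕ) =
        cyclicPeakPoly (h ∘ some ∘ (Subtype.val : {x // x ≠ a} → Fin (n + 1))) :=
    let e : {x // x ≠ a} ≃o Fin n := (Fintype.orderIsoFinOfCardEq _ (by simp)).symm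
    cyclicPeakPoly_congr e.toEquiv fun _ _ => e.lt_iff_lt
  rw [← h1, cyclicPeakPoly_option (h := h) fun x => x.2]
  simp_rw [← h2]
  have h3 : h ∘ some = Fin.val := rfl
  rw [h3]
  simp
  ring

theorem derangementPoly_cpk_zero : derangementPoly cpk (X : ℚ[X]) 0 = 1 := by
  have h : (Finset.univ : Finset (derangements (Fin 0))) = {⟨1, fun x => x.elim0⟩} := by decide
  simp [derangementPoly, h, cpk]

theorem derangementPoly_cpk_one : derangementPoly cpk (X : ℚ[X]) 1 = 0 := by
  have h : (Finset.univ : Finset (derangements (Fin 1))) = ∅ := by decide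
  simp [derangementPoly, h]

theorem derangementPoly_cpk_succ_succ (n : ℕ) :
    derangementPoly cpk (X : ℚ[X]) (n + 2) =
      2 * X * (1 - X) * derivative (derangementPoly cpk (X : ℚ[X]) (n + 1)) +
      ((n : ℚ[X]) + 1) * X *
        (derangementPoly cpk (X : ℚ[X]) (n + 1) + derangementPoly cpk (X : ℚ[X]) n) := by
  simp only [derangementPoly_cpk_X, cyclicPeakPoly_fin_succ_succ]

end DerangementRecurrence

/-! ### Transport equations for the generating functions -/

section GeneratingFunctions
open Polynomial

theorem coeff_expGenFun {R : Type*} [CommRing R] [Algebra ℚ R] (a : ℕ → R) (n : ℕ) :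
    PowerSeries.coeff n (expGenFun a) = ((n.factorial : ℚ)⁻¹) • a n :=
  PowerSeries.coeff_mk _ _

theorem map_expGenFun {R S : Type*} [CommRing R] [Algebra ℚ R] [CommRing S] [Algebra ℚ S]
    (f : R →ₐ[ℚ] S) (a : ℕ → R) :
    PowerSeries.map (f : R →+* S) (expGenFun a) = expGenFun fun n => f (a n) := by
  ext n
  simp [coeff_expGenFun]

/-- Differentiation of a power series over `ℚ[T]` with respect to `T`, coefficient by coefficient. -/
noncomputable def coeffDerivative (f : PowerSeries ℚ[X]) : PowerSeries ℚ[X] :=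
  PowerSeries.mk fun n => Polynomial.derivative (PowerSeries.coeff n f)

theorem coeff_coeffDerivative (f : PowerSeries ℚ[X]) (n : ℕ) :
    PowerSeries.coeff n (coeffDerivative f) = Polynomial.derivative (PowerSeries.coeff n f) :=
  PowerSeries.coeff_mk _ _

theorem coeffDerivative_mul (f g : PowerSeries ℚ[X]) :
    coeffDerivative (f * g) = coeffDerivative f * g + f * coeffDerivative g := by
  ext1 n
  simp only [map_add, PowerSeries.coeff_mul, coeff_coeffDerivative, derivative_sum,
    Polynomial.derivative_mul, Finset.sum_add_distrib]

theorem derivative_mul_eq {R : Type*} [CommRing R] (f g : PowerSeries R) :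
    PowerSeries.derivative R (f * g) =
      f * PowerSeries.derivative R g + g * PowerSeries.derivative R f := by
  rw [Derivation.leibniz, smul_eq_mul, smul_eq_mul]

/-- A power series with constant term `1` that satisfies a homogeneous transport equation is `1`. -/
theorem eq_one_of_transport {H : PowerSeries ℚ[X]} (u v : ℚ[X])
    (hH : (1 - PowerSeries.C u * PowerSeries.X) * PowerSeries.derivative ℚ[X] H =
      PowerSeries.C v * coeffDerivative H)
    (h0 : PowerSeries.constantCoeff H = 1) : H = 1 := by
  -- The coefficient of `x^n` expresses `(n+1) H_{n+1}` through `n H_n` and the derivative of `H_n`.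
  -- Both vanish for `n = 0`, as `H_0 = 1`, and thereafter by induction.
  have key (n : ℕ) : PowerSeries.coeff (n + 1) H = 0 := by
    have hne (n : ℕ) : ((n : ℚ[X]) + 1) ≠ 0 := by exact_mod_cast n.succ_ne_zero
    have hn (n : ℕ) := congrArg (PowerSeries.coeff n) hH
    simp only [sub_mul, one_mul, mul_assoc, map_sub, PowerSeries.coeff_C_mul,
      coeff_coeffDerivative, PowerSeries.coeff_derivative] at hn
    induction n with
    | zero => simpa [h0] using hn 0
    | succ n ih =>
      have h := hn (n + 1)
      rw [PowerSeries.coeff_succ_X_mul, PowerSeries.coeff_derivative, ih] at h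
      simp only [zero_mul, mul_zero, sub_zero, Polynomial.derivative_zero] at h
      exact (mul_eq_zero.1 h).resolve_right (hne (n + 1))
  ext1 n
  rcases n with _ | n
  · simpa using h0
  · rw [key, PowerSeries.coeff_one, if_neg n.succ_ne_zero]

/-- This is the recurrence that `expGenFun_transport` requires of the coefficients `-X * U_n` of W,
divided by `-X`; the term with `2 * (1 - X)` comes from differentiating the factor `X`. -/
theorem chebyshevU₂_derivative (n : ℕ) :
    2 * X * (1 - X) * Polynomial.derivative (chebyshevU₂ (X : ℚ[X]) 1 (n + 1)) =
      chebyshevU₂ X 1 (n + 2) - X * ((n : ℚ[X]) + 3) * chebyshevU₂ X 1 (n + 1)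
        - 2 * (1 - X) * chebyshevU₂ X 1 (n + 1) + X * ((n : ℚ[X]) + 3) * chebyshevU₂ X 1 n := by
  induction n using Nat.twoStepInduction with
  | zero => simp [chebyshevU₂]; ring
  | one => simp [chebyshevU₂]; ring
  | more n ih1 ih2 =>
    have e (m : ℕ) : chebyshevU₂ (X : ℚ[X]) 1 (m + 2) =
      2 * chebyshevU₂ X 1 (m + 1) - X * chebyshevU₂ X 1 m := by simp [chebyshevU₂]
    have d : Polynomial.derivative (chebyshevU₂ (X : ℚ[X]) 1 (n + 2 + 1)) =
        2 * Polynomial.derivative (chebyshevU₂ (X : ℚ[X]) 1 (n + 1 + 1)) -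
        chebyshevU₂ X 1 (n + 1) -
        X * Polynomial.derivative (chebyshevU₂ (X : ℚ[X]) 1 (n + 1)) := by
      rw [e (n + 1)]; simp; ring
    rw [d]
    have e1 := e (n + 2)
    have e2 := e (n + 1)
    have e3 := e n
    push_cast at ih2 ⊢
    simp only [add_assoc, Nat.reduceAdd] at *
    rw [e1, e2, e3]
    rw [e2, e3] at ih2
    rw [e3] at ih1
    linear_combination 2 * ih2 - X * ih1

/-- A second-order recurrence for a sequence of polynomials, as a partial differential equation for
its exponential generating function. -/
theorem expGenFun_transport {a : ℕ → ℚ[X]} (u v c : ℚ[X])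
    (h1 : a 1 = v * Polynomial.derivative (a 0))
    (h2 : ∀ n, a (n + 2) = u * (n + 1) * a (n + 1) + v * Polynomial.derivative (a (n + 1)) +
      c * (n + 1) * a n) :
    (1 - PowerSeries.C u * PowerSeries.X) * PowerSeries.derivative ℚ[X] (expGenFun a) =
      PowerSeries.C v * coeffDerivative (expGenFun a) +
        PowerSeries.C c * PowerSeries.X * expGenFun a := by
  have hc (n : ℕ) (p : ℚ[X]) : (((n + 1).factorial : ℚ)⁻¹ • p) * ((n : ℚ[X]) + 1) =
      (n.factorial : ℚ)⁻¹ • p := by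
    have : ((n : ℚ[X]) + 1) = Polynomial.C ((n : ℚ) + 1) := by simp
    rw [this, mul_comm, ← Polynomial.smul_eq_C_mul, smul_smul]
    congr 1
    rw [Nat.factorial_succ]
    push_cast
    have : (n : ℚ) + 1 ≠ 0 := by positivity
    field_simp
  ext1 n
  rw [sub_mul, one_mul, mul_assoc, mul_assoc]
  simp only [map_sub, map_add, PowerSeries.coeff_C_mul, coeff_coeffDerivative,
    PowerSeries.coeff_derivative, coeff_expGenFun, hc]
  rcases n with _ | n
  · simp [h1]
  · simp only [PowerSeries.coeff_succ_X_mul, PowerSeries.coeff_derivative, coeff_expGenFun, hc, h2]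
    rw [← hc n (a (n + 1)), ← hc n (a n), Polynomial.derivative_smul]
    simp only [Polynomial.smul_eq_C_mul]
    ring

theorem one_sub_C_mul_chebyshevV {R : Type*} [CommRing R] [Algebra ℚ R] (t : R) :
    1 - PowerSeries.C t * chebyshevV t 1 = expGenFun fun m => match m with
      | 0 => 1
      | 1 => 0
      | n + 2 => -(t * chebyshevU₂ t 1 n) := by
  ext1 m
  rw [chebyshevV, map_sub, PowerSeries.coeff_C_mul, coeff_expGenFun, coeff_expGenFun,
    PowerSeries.coeff_one]
  rcases m with _ | _ | m <;> simp

theorem derangementEGF_X_mul :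
    derangementEGF (X : ℚ[X]) * (1 - PowerSeries.C X * chebyshevV X 1) = 1 := by
  have hF := expGenFun_transport (a := derangementPoly cpk (X : ℚ[X])) X (2 * X * (1 - X)) X
    (by simp [derangementPoly_cpk_one, derangementPoly_cpk_zero])
    (fun n => by rw [derangementPoly_cpk_succ_succ]; ring)
  have hW := expGenFun_transport (a := fun m => match m with
      | 0 => 1
      | 1 => 0
      | n + 2 => -((X : ℚ[X]) * chebyshevU₂ X 1 n)) X (2 * X * (1 - X)) (-X)
    (by simp) (fun n => by
      rcases n with _ | _ | n
      · simp [chebyshevU₂]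
      · simp [chebyshevU₂]; ring
      · have := chebyshevU₂_derivative n
        simp only [Polynomial.derivative_neg, Polynomial.derivative_mul, Polynomial.derivative_X]
        push_cast
        linear_combination X * this)
  rw [← one_sub_C_mul_chebyshevV] at hW
  rw [← derangementEGF] at hF
  refine eq_one_of_transport X (2 * X * (1 - X)) ?_ ?_
  · rw [coeffDerivative_mul, derivative_mul_eq]
    rw [map_neg] at hW
    -- The zeroth-order terms, with coefficients `X` and `-X`, cancel.
    linear_combination derangementEGF X * hW + (1 - PowerSeries.C X * chebyshevV X 1) * hF
  · rw [map_mul, constantCoeff_derangementEGF, one_sub_C_mul_chebyshevV,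
      ← PowerSeries.coeff_zero_eq_constantCoeff_apply, coeff_expGenFun]
    simp

theorem map_chebyshevU₂ {R S : Type*} [CommRing R] [CommRing S] (f : R →+* S) (s t : R) (n : ℕ) :
    f (chebyshevU₂ s t n) = chebyshevU₂ (f s) (f t) n := by
  induction n using Nat.twoStepInduction with
  | zero => simp [chebyshevU₂]
  | one => simp [chebyshevU₂, map_ofNat]
  | more n ih1 ih2 => simp [chebyshevU₂, ih1, ih2, map_ofNat]

/-- All coefficients are rational polynomials in `t`, so the identity over `ℚ[X]` specialises along
evaluation at `t`. -/
theorem derangementEGF_mul {R : Type*} [CommRing R] [Algebra ℚ R] (t : R) :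
    derangementEGF t * (1 - PowerSeries.C t * chebyshevV t 1) = 1 := by
  have h := congrArg (PowerSeries.map (Polynomial.aeval (R := ℚ) t : ℚ[X] →+* R))
    derangementEGF_X_mul
  rw [map_mul, map_one, one_sub_C_mul_chebyshevV, derangementEGF, map_expGenFun,
    map_expGenFun] at h
  rw [one_sub_C_mul_chebyshevV, derangementEGF, ← h]
  congr 2
  · funext n
    simp [derangementPoly]
  · funext n
    rcases n with _ | _ | n
    · simp
    · simp
    · have := map_chebyshevU₂ (Polynomial.aeval (R := ℚ) t : ℚ[X] →+* R) X 1 n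
      simp only [RingHom.coe_coe, map_one, Polynomial.aeval_X] at this
      simp [this]

theorem chebyshevU₂_neg_one_one (n : ℕ) : chebyshevU₂ (-1 : ℚ) 1 n = pell (n + 2) := by
  induction n using Nat.twoStepInduction with
  | zero => simp [chebyshevU₂, pell]
  | one => simp [chebyshevU₂, pell]
  | more n ih1 ih2 =>
    rw [chebyshevU₂, pell, ih1, ih2]
    push_cast
    ring

theorem pellEGF_eq : pellEGF = 1 - PowerSeries.C (-1) * chebyshevV (-1) 1 := by
  rw [one_sub_C_mul_chebyshevV, pellEGF]
  congr 1
  funext n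
  rcases n with _ | _ | n
  · simp [pell]
  · simp [pell]
  · simp [chebyshevU₂_neg_one_one]

end GeneratingFunctions

theorem mainTheorem9 :
    (∀ (R : Type*) [CommRing R] [Algebra ℚ R] (t : R),
      derangementEGF t * (1 - PowerSeries.C t * chebyshevV t 1) = 1) ∧
    derangementEGF (-1 : ℚ) * pellEGF = 1 := by
  refine ⟨fun R _ _ t => derangementEGF_mul t, ?_⟩
  rw [pellEGF_eq]
  exact derangementEGF_mul (-1)
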